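/- Let $C$ be a finite set of $n$ agents and $A$ a finite non-empty set of alternatives, located in a common (pseudo)metric space with distance $d$, and let each agent $j$ have a total preference order on $A$ consistent with $d$ (if $j$ prefers $a$ to $b$ then $d(j,a)\le d(j,b)$), with top choice $\mathrm{top}(j)\in A$. Let $k\ge 1$ and $1\le \ell\le n$ be integers. For $\emptyset\ne S\subseteq A$ put $d(j,S)=\min_{a\in S}d(j,a)$, and let $\mathrm{Top}_\ell(d(C,S))$ be the sum of the $\ell$ largest entries of the vector $(d(j,S))_{j\in C}$. Let $\mathrm{OPT}$ be the minimum of $\mathrm{Top}_\ell(d(C,S))$ over all non-empty $S\subseteq A$ with $|S|\le k$ (the $\ell$-centrum problem), let $S^*$ be an optimal solution, and let $B\ge \mathrm{OPT}$. For $\nu\in\{0,1\}$ consider the following algorithm, with $f=B/k$, on a sequence of agents $x_1,\dots,x_n$. Start with $S=\{\mathrm{top}(x_1)\}$. For $i=2,\dots,n$, let $\delta_i=\bigl(d(x_i,S)-(3+\nu)\tfrac{B}{\ell}\bigr)^+$ and, independently of everything before, add $\mathrm{top}(x_i)$ to $S$ with probability $\min(1,\delta_i/f)$. (If $f=0$,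 this probability is read as $1$ when $\delta_i>0$ and as $0$ when $\delta_i=0$.) Return $S$. Suppose that, for some $\nu\in\{0,1\}$, $d(j,\mathrm{top}(j))\le \nu\cdot d(j,S^*)$ for all $j\in C$, and that $x_1,\dots,x_n$ is a uniformly random ordering of the agents. Then the returned set $S$ satisfies $$\mathbb E\,|S|\le (26+16\nu)\,k\qquad\text{and}\qquad \mathbb E\bigl[\mathrm{Top}_\ell(d(C,S))\bigr]\le (15+4\nu)\,B+(14+13\nu)\,\mathrm{OPT}.$$ In particular, if $A=C$, consider the algorithm that starts with $S=\{x_1\}$ and, for $i=2,\dots,n$, adds $x_i$ to $S$ with probability $\min(1,\delta_i/f)$, where $\delta_i=\bigl(d(x_i,S)-3\tfrac{B}{\ell}\bigr)^+$. On a uniformly random ordering of the agents it satisfies $\mathbb E\,|S|\le 26k$ and $\mathbb E[\mathrm{Top}_\ell(d(C,S))]\le 15B+14\,\mathrm{OPT}$. -/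

import Mathlib

open scoped ENNReal

noncomputable section

namespace LCentrum

/-- The `Top_ℓ`-cost of a vector: sort its entries in non-increasing order (with multiplicity)
and add up the first `ℓ` of them. -/
def topCost {C : Type*} [Fintype C] (ℓ : ℕ) (v : C → ℝ) : ℝ :=
  (((Finset.univ.val.map v).sort (fun x y => x ≥ y)).take ℓ).sum

/-- `d(j, S) = min_{a ∈ S} d(j, a)` for a non-empty finite set `S` of alternatives
(the value `0` for `S = ∅` is never used below: all sets that occur are non-empty). -/
def distTo {C A : Type*} (d : C → A → ℝ) (j : C) (S : Finset A) : ℝ :=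
  if h : S.Nonempty then S.inf' h (d j) else 0

/-- The `ℓ`-centrum cost of `S`: the `Top_ℓ`-cost of the cost vector `d(C, S)`. -/
def cost {C A : Type*} [Fintype C] (d : C → A → ℝ) (ℓ : ℕ) (S : Finset A) : ℝ :=
  topCost ℓ (fun j => distTo d j S)

/-- Solutions of the `k`-committee election problem: non-empty sets of at most `k` alternatives. -/
def Feasible {A : Type*} (k : ℕ) (S : Finset A) : Prop :=
  S.Nonempty ∧ S.card ≤ k

/-- `S` is an optimal solution of the `ℓ`-centrum problem. -/
def IsOptimal {C A : Type*} [Fintype C] (d : C → A → ℝ) (k ℓ : ℕ) (S : Finset A) : Prop :=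
  Feasible k S ∧ ∀ T : Finset A, Feasible k T → cost d ℓ S ≤ cost d ℓ T

/-- The optimal `ℓ`-centrum cost. -/
def OPT {C A : Type*} [Fintype C] (d : C → A → ℝ) (k ℓ : ℕ) : ℝ :=
  sInf (cost d ℓ '' {S : Finset A | Feasible k S})

/-- A preference profile: one total order on the alternatives for each agent, where
`(σ i).le b a` means that agent `i` weakly prefers `a` to `b`. -/
abbrev Profile (C A : Type*) := C → LinearOrder A

/-- The distances are consistent with the profile: a preferred alternative is no farther away. -/
def Consistent {C A : Type*} (d : C → A → ℝ) (σ : Profile C A) : Prop :=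
  ∀ (i : C) (a b : A), (σ i).le b a → d i a ≤ d i b

/-- The top choice of agent `i`, i.e. the greatest alternative in the preference order of `i`. -/
def top {C A : Type*} [Fintype A] [Nonempty A] (σ : Profile C A) (i : C) : A :=
  @Finset.max' A (σ i) Finset.univ Finset.univ_nonempty

/-- `min(1, δ⁺ / f)` as an extended non-negative real, with the conventions of `ℝ≥0∞` in the
degenerate case `f = 0`: the value is `1` if `δ > 0` and `0` if `δ ≤ 0`. -/
def openProb (δ f : ℝ) : ℝ≥0∞ :=
  min 1 (ENNReal.ofReal δ / ENNReal.ofReal f)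

/-- A coin that shows `true` with probability `openProb δ f`. -/
def coin (δ f : ℝ) : PMF Bool :=
  PMF.ofFintype (fun b => bif b then openProb δ f else 1 - openProb δ f)
    (by simp [openProb])

/-- The loop of the algorithm. `S` is the current set of open facilities; the next agent `x` has
`δ = (d(x, S) - thr)⁺` and the facility `fac x` is added to `S` with probability `min(1, δ / f)`,
by a fresh independent coin. -/
def meyersonLoop {C A : Type*} [DecidableEq A] (d : C → A → ℝ) (fac : C → A) (thr f : ℝ) :
    List C → Finset A → PMF (Finset A)
  | [], S => PMF.pure S
  | x :: xs, S =>
    (coin (max (distTo d x S - thr) 0) f).bind fun b =>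
      meyersonLoop d fac thr f xs (if b then insert (fac x) S else S)

/-- The algorithm on a sequence of agents: the facility of the first agent is opened, then the
other agents are considered one after the other. The result is the law of the returned set. -/
def meyerson {C A : Type*} [DecidableEq A] (d : C → A → ℝ) (fac : C → A) (thr f : ℝ) :
    List C → PMF (Finset A)
  | [] => PMF.pure ∅
  | x :: xs => meyersonLoop d fac thr f xs {fac x}

instance orderNonempty (C : Type*) [Fintype C] : Nonempty (Fin (Fintype.card C) ≃ C) :=
  ⟨(Fintype.equivFin C).symm⟩

/-- The algorithm on a uniformly random ordering `x₁, …, xₙ` of all agents. -/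
def randomOrderMeyerson {C A : Type*} [Fintype C] [DecidableEq C] [DecidableEq A]
    (d : C → A → ℝ) (fac : C → A) (thr f : ℝ) : PMF (Finset A) :=
  (PMF.uniformOfFintype (Fin (Fintype.card C) ≃ C)).bind fun x =>
    meyerson d fac thr f (List.ofFn x)

/-- Meyerson's algorithm adapted to `ℓ`-centrum, alternatives distinct from agents: agent `x`
opens `top(x)`, the facility cost is `B / k` and the threshold `(3 + ν) B / ℓ`. -/
def meyersonTopGen {C A : Type*} [Fintype C] [DecidableEq C] [Fintype A] [DecidableEq A]
    [Nonempty A] (d : C → A → ℝ) (σ : Profile C A) (k ℓ : ℕ) (ν B : ℝ) : PMF (Finset A) :=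
  randomOrderMeyerson d (top σ) ((3 + ν) * (B / ℓ)) (B / k)

/-- Meyerson's algorithm adapted to `ℓ`-centrum, alternatives equal to agents: agent `x`
opens `x` itself, the facility cost is `B / k` and the threshold `3 B / ℓ`. -/
def meyersonTop {C : Type*} [Fintype C] [DecidableEq C]
    (d : C → C → ℝ) (k ℓ : ℕ) (B : ℝ) : PMF (Finset C) :=
  randomOrderMeyerson d id (3 * (B / ℓ)) (B / k)

/-- Expectation of `g` under a probability distribution on a finite type. -/
def expect {Ω : Type*} [Fintype Ω] (p : PMF Ω) (g : Ω → ℝ) : ℝ :=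
  ∑ ω, (p ω).toReal * g ω

end LCentrum

end

/-!
Write `t = B / ℓ` and `f = B / k`, let `S*` be an optimal solution, and let
`r j = (d(j, S*) - t)⁺`. As the `ℓ` largest distances to `S*` add up to at most `ℓ t`, all distances
above `t` are among them, so `∑ r j ≤ OPT` (`sum_excess_le_topCost`). Conversely the cost of any
set `S` is at most `ℓ` times the threshold plus the sum of the excesses over the threshold. A client
with excess `δ` opens its facility with probability `p = min(1, δ / f)` and `(1 - p) δ ≤ f p`, so
both claims follow from a bound on the expected number `Q` of facilities opened after the first:
the expected size is at most `1 + Q` (`expect_card_randomOrderMeyerson_le`), and the expected excess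
is at most `f Q + ν ∑ r j` (`expect_excess_randomOrderMeyerson_le`).

`Q` is bounded cluster by cluster, where a cluster `K` consists of the clients with the same nearest
centre in `S*`. Call a client good if `(1 + ν) r j` is at most `t` or at most twice its average over
`K`; by Markov's inequality at least half of the clients are good. Once a good client has opened its
facility, the triangle inequality and the threshold `(3 + ν) t` bound the excess of every
client `j` of `K` by `r j` plus twice the average of `(1 + ν) r`, and these bounds add up to
`(3 + 2ν) ∑_K r`. Before that, the good clients open only one facility. A bad client `x` satisfies
`t ≤ (1 + ν) r x`, so that its excess is larger by at most `(4 + 2ν) r x` than the excess that any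
good client `g` has at the same moment or had earlier. If `g` precedes `x`, then `x` is
charged to `g`. If `x` precedes `g`, then `g` was equally likely to be considered at that moment;
this is where the random order is used. Hence the expected payment of `x` is at most twice the sum
of that of `g` and the additive term (`avgOrders_single_le`). Averaging over the good clients `g`, the
bad clients open at most `2` facilities, plus additive terms (`avgOrders_cluster_le`). Altogether
`Q ≤ 3 k + (11 + 6ν) OPT / f`, which leaves room in the claimed constants.

The randomness of the order is handled by recursion: `avgOrders U` averages over the orderings of
the set `U` of clients that are still to come, the first of which is uniform in `U`
(`avgOrders_rec`). No event about the past is needed, since "a good client has opened its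
facility" is replaced by "the facility of a good client is open", a condition on the current set.
-/

namespace LCentrum

/-! ### Expectations over finite probability spaces -/

section Expect

variable {Ω Ω' : Type*} [Fintype Ω] [Fintype Ω']

theorem expect_pure [DecidableEq Ω] (a : Ω) (g : Ω → ℝ) : expect (PMF.pure a) g = g a := by
  unfold expect
  rw [Finset.sum_eq_single a]
  · simp
  · intro b _ hb
    simp [PMF.pure_apply, hb]
  · simp

theorem expect_bind (p : PMF Ω') (F : Ω' → PMF Ω) (g : Ω → ℝ) :
    expect (p.bind F) g = expect p (fun a => expect (F a) g) := by
  unfold expect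
  have h : ∀ ω, ((p.bind F) ω).toReal = ∑ a, (p a).toReal * (F a ω).toReal := by
    intro ω
    rw [PMF.bind_apply, tsum_fintype, ENNReal.toReal_sum]
    · simp [ENNReal.toReal_mul]
    · intro a _
      exact ENNReal.mul_ne_top (PMF.apply_ne_top _ _) (PMF.apply_ne_top _ _)
  simp_rw [h, Finset.sum_mul, Finset.mul_sum]
  rw [Finset.sum_comm]
  simp [mul_assoc]

theorem expect_mono (p : PMF Ω) {g h : Ω → ℝ} (H : ∀ ω, g ω ≤ h ω) :
    expect p g ≤ expect p h :=
  Finset.sum_le_sum fun ω _ => mul_le_mul_of_nonneg_left (H ω) ENNReal.toReal_nonneg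

/-- Only outcomes of positive probability matter when expectations are compared. -/
theorem expect_mono_support (p : PMF Ω) {g h : Ω → ℝ} (H : ∀ ω ∈ p.support, g ω ≤ h ω) :
    expect p g ≤ expect p h := by
  refine Finset.sum_le_sum fun ω _ => ?_
  by_cases hω : ω ∈ p.support
  · exact mul_le_mul_of_nonneg_left (H ω hω) ENNReal.toReal_nonneg
  · rw [PMF.mem_support_iff, not_not] at hω
    simp [hω]

theorem sum_toReal (p : PMF Ω) : ∑ ω, (p ω).toReal = 1 := by
  have h := p.tsum_coe
  rw [tsum_fintype] at h
  rw [← ENNReal.toReal_sum fun ω _ => PMF.apply_ne_top _ _, h, ENNReal.toReal_one]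

theorem expect_const (p : PMF Ω) (c : ℝ) : expect p (fun _ => c) = c := by
  unfold expect
  rw [← Finset.sum_mul, sum_toReal, one_mul]

theorem expect_add (p : PMF Ω) (g h : Ω → ℝ) :
    expect p (fun ω => g ω + h ω) = expect p g + expect p h := by
  simp [expect, mul_add, Finset.sum_add_distrib]

end Expect

/-! ### The opening probability -/

/-- `openProb` as a real number. -/
noncomputable def prob (δ f : ℝ) : ℝ := (openProb δ f).toReal

theorem openProb_le_one (δ f : ℝ) : openProb δ f ≤ 1 := min_le_left _ _

theorem prob_nonneg (δ f : ℝ) : 0 ≤ prob δ f := ENNReal.toReal_nonneg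

theorem prob_le_one (δ f : ℝ) : prob δ f ≤ 1 :=
  ENNReal.toReal_mono ENNReal.one_ne_top (openProb_le_one δ f)

theorem expect_coin (δ f : ℝ) (g : Bool → ℝ) :
    expect (coin δ f) g = prob δ f * g true + (1 - prob δ f) * g false := by
  have h : (1 - openProb δ f).toReal = 1 - prob δ f := by
    rw [ENNReal.toReal_sub_of_le (openProb_le_one δ f) ENNReal.one_ne_top]
    rfl
  simp [expect, coin, prob, h]

theorem prob_of_pos {δ f : ℝ} (hf : 0 < f) (hδ : 0 ≤ δ) : prob δ f = min 1 (δ / f) := by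
  unfold prob openProb
  rw [← ENNReal.ofReal_div_of_pos hf, ENNReal.toReal_min ENNReal.one_ne_top ENNReal.ofReal_ne_top,
    ENNReal.toReal_ofReal (by positivity)]
  rfl

theorem prob_zero (f : ℝ) : prob 0 f = 0 := by
  simp [prob, openProb]

theorem prob_of_pos_zero {δ : ℝ} (hδ : 0 < δ) : prob δ 0 = 1 := by
  have : ENNReal.ofReal δ ≠ 0 := by simpa using hδ
  simp [prob, openProb, ENNReal.div_zero this]

/-- The opening probability is `1 / f`-Lipschitz from above. For `f = 0` the quotient `c / f` is
`0`, and the inequality is monotonicity. -/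
theorem prob_le_add {δ δ' c f : ℝ} (hf : 0 ≤ f) (hδ : 0 ≤ δ) (hδ' : 0 ≤ δ') (hc : 0 ≤ c)
    (hfc : f = 0 → c = 0) (h : δ' ≤ δ + c) : prob δ' f ≤ prob δ f + c / f := by
  rcases hf.eq_or_lt with rfl | hf
  · rw [hfc rfl] at h ⊢
    rcases hδ'.eq_or_lt with rfl | hδ'
    · rw [prob_zero]; simpa using prob_nonneg _ _
    · rw [prob_of_pos_zero hδ', prob_of_pos_zero (by linarith)]; simp
  · rw [prob_of_pos hf hδ, prob_of_pos hf hδ']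
    have h1 : δ' / f ≤ δ / f + c / f := by rw [← add_div]; gcongr
    have h2 : 0 ≤ c / f := by positivity
    rcases min_choice 1 (δ / f) with h3 | h3 <;> rw [h3]
    · linarith [min_le_left 1 (δ' / f)]
    · linarith [min_le_right 1 (δ' / f)]

/-- The expected excess of a client that does not open its facility is at most the expected
opening cost. -/
theorem one_sub_prob_mul_le {δ f : ℝ} (hf : 0 ≤ f) (hδ : 0 ≤ δ) :
    (1 - prob δ f) * δ ≤ f * prob δ f := by
  rcases hf.eq_or_lt with rfl | hf
  · rcases hδ.eq_or_lt with rfl | hδ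
    · simp
    · simp [prob_of_pos_zero hδ]
  · have h1 : 0 ≤ prob δ f := prob_nonneg _ _
    rw [prob_of_pos hf hδ] at *
    rcases le_total 1 (δ / f) with h | h
    · simp [min_eq_left h, hf.le]
    · rw [min_eq_right h] at *
      rw [mul_div_cancel₀ _ hf.ne']
      nlinarith

/-! ### Averages over the orderings of a finite set -/

section Orders

variable {C : Type*} [DecidableEq C]

/-- The orderings of a finite set, as lists that contain every element exactly once. -/
noncomputable def orders (U : Finset C) : Finset (List C) := U.toList.permutations.toFinset

theorem mem_orders {U : Finset C} {l : List C} :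
    l ∈ orders U ↔ l.Nodup ∧ ∀ x, x ∈ l ↔ x ∈ U := by
  rw [orders, List.mem_toFinset, List.mem_permutations]
  constructor
  · intro h
    exact ⟨h.nodup_iff.2 U.nodup_toList, fun x => by rw [h.mem_iff, Finset.mem_toList]⟩
  · rintro ⟨h1, h2⟩
    rw [List.perm_ext_iff_of_nodup h1 U.nodup_toList]
    simpa using h2

theorem card_orders (U : Finset C) : (orders U).card = U.card.factorial := by
  rw [orders, List.toFinset_card_of_nodup (List.nodup_permutations _ U.nodup_toList),
    List.length_permutations, Finset.length_toList]

/-- The average of `F` over the orderings of `U`. -/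
noncomputable def avgOrders (U : Finset C) (F : List C → ℝ) : ℝ :=
  (∑ l ∈ orders U, F l) / U.card.factorial

theorem sum_orders {U : Finset C} (hU : U.Nonempty) (F : List C → ℝ) :
    ∑ l ∈ orders U, F l = ∑ x ∈ U, ∑ l ∈ orders (U.erase x), F (x :: l) := by
  rw [Finset.sum_sigma']
  symm
  refine Finset.sum_bij (fun p _ => p.1 :: p.2) ?_ ?_ ?_ ?_
  · rintro ⟨x, l⟩ h
    simp only [Finset.mem_sigma, mem_orders, Finset.mem_erase] at h ⊢
    obtain ⟨hx, hl, h⟩ := h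
    refine ⟨List.nodup_cons.2 ⟨fun hm => ((h x).1 hm).1 rfl, hl⟩, fun y => ?_⟩
    rw [List.mem_cons, h]
    constructor
    · rintro (rfl | h)
      exacts [hx, h.2]
    · intro hy
      by_cases hyx : y = x
      exacts [Or.inl hyx, Or.inr ⟨hyx, hy⟩]
  · rintro ⟨x, l⟩ _ ⟨y, l'⟩ _ h
    simp only [List.cons.injEq] at h
    obtain ⟨rfl, rfl⟩ := h
    rfl
  · intro l hl
    rw [mem_orders] at hl
    obtain ⟨hn, hm⟩ := hl
    cases l with
    | nil =>
      obtain ⟨x, hx⟩ := hU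
      simpa using (hm x).2 hx
    | cons x l =>
      refine ⟨⟨x, l⟩, ?_, rfl⟩
      rw [List.nodup_cons] at hn
      simp only [Finset.mem_sigma, mem_orders, Finset.mem_erase]
      refine ⟨(hm x).1 List.mem_cons_self, hn.2, fun y => ⟨fun hy => ⟨?_, ?_⟩, fun hy => ?_⟩⟩
      · rintro rfl
        exact hn.1 hy
      · exact (hm y).1 (List.mem_cons_of_mem _ hy)
      · exact (List.mem_cons.1 ((hm y).2 hy.2)).resolve_left hy.1
  · intros
    rfl

/-- In a uniformly random ordering, the first element is uniformly random, and the others follow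
in uniformly random order. -/
theorem avgOrders_rec {U : Finset C} (hU : U.Nonempty) (F : List C → ℝ) :
    avgOrders U F = (∑ x ∈ U, avgOrders (U.erase x) (fun l => F (x :: l))) / U.card := by
  have hc : ∀ x ∈ U, (U.erase x).card.factorial = (U.card - 1).factorial := by
    intro x hx
    rw [Finset.card_erase_of_mem hx]
  unfold avgOrders
  rw [sum_orders hU, Finset.sum_div, Finset.sum_div]
  refine Finset.sum_congr rfl fun x hx => ?_
  rw [hc x hx, div_div]
  congr 1
  rw [← Nat.mul_factorial_pred (Finset.card_pos.2 hU).ne']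
  push_cast
  ring

theorem avgOrders_mono {U : Finset C} {F G : List C → ℝ} (h : ∀ l ∈ orders U, F l ≤ G l) :
    avgOrders U F ≤ avgOrders U G :=
  div_le_div_of_nonneg_right (Finset.sum_le_sum h) (Nat.cast_nonneg _)

theorem avgOrders_const (U : Finset C) (c : ℝ) : avgOrders U (fun _ => c) = c := by
  have : (U.card.factorial : ℝ) ≠ 0 := by exact_mod_cast U.card.factorial_ne_zero
  rw [avgOrders, Finset.sum_const, card_orders, nsmul_eq_mul, mul_div_cancel_left₀ _ this]

theorem avgOrders_le {U : Finset C} {F : List C → ℝ} {c : ℝ} (h : ∀ l ∈ orders U, F l ≤ c) :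
    avgOrders U F ≤ c :=
  (avgOrders_mono h).trans_eq (avgOrders_const U c)

theorem avgOrders_nonneg {U : Finset C} {F : List C → ℝ} (h : ∀ l, 0 ≤ F l) :
    0 ≤ avgOrders U F :=
  div_nonneg (Finset.sum_nonneg fun l _ => h l) (Nat.cast_nonneg _)

theorem avgOrders_add (U : Finset C) (F G : List C → ℝ) :
    avgOrders U (fun l => F l + G l) = avgOrders U F + avgOrders U G := by
  simp [avgOrders, Finset.sum_add_distrib, add_div]

theorem avgOrders_sum {ι : Type*} (s : Finset ι) (U : Finset C) (F : ι → List C → ℝ) :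
    avgOrders U (fun l => ∑ i ∈ s, F i l) = ∑ i ∈ s, avgOrders U (F i) := by
  simp only [avgOrders]
  rw [Finset.sum_comm, Finset.sum_div]

theorem avgOrders_mul_left (U : Finset C) (c : ℝ) (F : List C → ℝ) :
    avgOrders U (fun l => c * F l) = c * avgOrders U F := by
  simp [avgOrders, ← Finset.mul_sum, mul_div_assoc]

/-- Bijections from `Fin n` are the same as orderings of the whole type. -/
theorem sum_equiv_ofFn [Fintype C] (F : List C → ℝ) :
    ∑ e : Fin (Fintype.card C) ≃ C, F (List.ofFn e) = ∑ l ∈ orders Finset.univ, F l := by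
  refine Finset.sum_bij (fun e _ => List.ofFn e) ?_ ?_ ?_ ?_
  · intro e _
    rw [mem_orders]
    refine ⟨List.nodup_ofFn.2 e.injective, fun x => ?_⟩
    simpa [List.mem_ofFn] using e.surjective x
  · intro e _ e' _ h
    exact DFunLike.coe_injective (List.ofFn_injective h)
  · intro l hl
    have hlen : l.length = Fintype.card C := by
      rw [mem_orders] at hl
      rw [← List.toFinset_card_of_nodup hl.1, Finset.eq_univ_of_forall (s := l.toFinset)
        (fun x => by simp [hl.2 x]), Finset.card_univ]
    rw [mem_orders] at hl
    have hinj : Function.Injective (fun i : Fin (Fintype.card C) => l.get (i.cast hlen.symm)) :=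
      (List.nodup_iff_injective_get.1 hl.1).comp (Fin.cast_injective _)
    refine ⟨Equiv.ofBijective _ ((Fintype.bijective_iff_injective_and_card _).2
      ⟨hinj, by simp⟩), Finset.mem_univ _, ?_⟩
    apply List.ext_get
    · simp [hlen]
    · intros
      simp
  · intros
    rfl

theorem expect_uniform_ofFn [Fintype C] (F : List C → ℝ) :
    expect (PMF.uniformOfFintype (Fin (Fintype.card C) ≃ C)) (fun e => F (List.ofFn e))
      = avgOrders Finset.univ F := by
  unfold expect avgOrders
  simp only [PMF.uniformOfFintype_apply]
  rw [← Finset.mul_sum, sum_equiv_ofFn, Fintype.card_equiv (Fintype.equivFin C).symm]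
  simp [div_eq_inv_mul]

end Orders

/-! ### Expected sums along a run -/

/-- The summand that counts `w` for the client `x` only. -/
def single {C A : Type*} [DecidableEq C] (w : C → Finset A → ℝ) (x : C) : C → Finset A → ℝ :=
  fun y S => if y = x then w y S else 0

theorem single_nonneg {C A : Type*} [DecidableEq C] {w : C → Finset A → ℝ} (hw : ∀ x S, 0 ≤ w x S) (x y : C) (S : Finset A) :
    0 ≤ single w x y S := by
  unfold single
  split_ifs
  exacts [hw y S, le_rfl]

section Run

variable {C A : Type*} [DecidableEq A]

/-- Suppose that client `x` opens `fac x` with probability `q x S` when `S` is the current set.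
This is the expectation, over the coins, of the sum of `φ x S` over all clients `x` of the list,
where `S` is the set of open facilities at the moment at which `x` is considered. -/
def runSum (q : C → Finset A → ℝ) (fac : C → A) (φ : C → Finset A → ℝ) :
    List C → Finset A → ℝ
  | [], _ => 0
  | x :: xs, S => φ x S + (q x S * runSum q fac φ xs (insert (fac x) S)
      + (1 - q x S) * runSum q fac φ xs S)

variable {q : C → Finset A → ℝ} {fac : C → A}

/-- The monotonicity of `runSum`, for summands that need to be compared only on sets with a
property which is inherited by supersets. -/
theorem runSum_mono_of (hq0 : ∀ x S, 0 ≤ q x S) (hq1 : ∀ x S, q x S ≤ 1)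
    {φ ψ : C → Finset A → ℝ} {P : Finset A → Prop} (hP : ∀ S a, P S → P (insert a S))
    (h : ∀ x S, P S → φ x S ≤ ψ x S) (l : List C) :
    ∀ S, P S → runSum q fac φ l S ≤ runSum q fac ψ l S := by
  induction l with
  | nil => intro S _; simp [runSum]
  | cons x l ih =>
    intro S hS
    have h1 := mul_le_mul_of_nonneg_left (ih _ (hP S (fac x) hS)) (hq0 x S)
    have h2 := mul_le_mul_of_nonneg_left (ih _ hS) (sub_nonneg.2 (hq1 x S))
    have h3 := h x S hS
    simp only [runSum]
    linarith

theorem runSum_mono (hq0 : ∀ x S, 0 ≤ q x S) (hq1 : ∀ x S, q x S ≤ 1)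
    {φ ψ : C → Finset A → ℝ} (h : ∀ x S, φ x S ≤ ψ x S) (l : List C) (S : Finset A) :
    runSum q fac φ l S ≤ runSum q fac ψ l S :=
  runSum_mono_of hq0 hq1 (P := fun _ => True) (fun _ _ _ => trivial) (fun x S _ => h x S) l S
    trivial

theorem runSum_zero (l : List C) : ∀ S, runSum q fac (fun _ _ => 0) l S = 0 := by
  induction l with
  | nil => intro S; rfl
  | cons x l ih => intro S; simp [runSum, ih]

theorem runSum_nonneg (hq0 : ∀ x S, 0 ≤ q x S) (hq1 : ∀ x S, q x S ≤ 1)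
    {φ : C → Finset A → ℝ} (h : ∀ x S, 0 ≤ φ x S) (l : List C) (S : Finset A) :
    0 ≤ runSum q fac φ l S :=
  (runSum_zero (q := q) (fac := fac) l S).ge.trans (runSum_mono hq0 hq1 h l S)

theorem runSum_add (φ ψ : C → Finset A → ℝ) (l : List C) :
    ∀ S, runSum q fac (fun x S => φ x S + ψ x S) l S
      = runSum q fac φ l S + runSum q fac ψ l S := by
  induction l with
  | nil => intro S; simp [runSum]
  | cons x l ih => intro S; simp only [runSum, ih]; ring

theorem runSum_sum {ι : Type*} (s : Finset ι) (φ : ι → C → Finset A → ℝ) (l : List C) :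
    ∀ S, runSum q fac (fun x S => ∑ i ∈ s, φ i x S) l S = ∑ i ∈ s, runSum q fac (φ i) l S := by
  induction l with
  | nil => intro S; simp [runSum]
  | cons x l ih =>
    intro S
    simp only [runSum, ih, Finset.sum_add_distrib, Finset.mul_sum]

theorem runSum_const (e : C → ℝ) (l : List C) :
    ∀ S, runSum q fac (fun x _ => e x) l S = (l.map e).sum := by
  induction l with
  | nil => intro S; simp [runSum]
  | cons x l ih => intro S; simp only [runSum, ih, List.map_cons, List.sum_cons]; ring

/-- Let `N` be a property of sets that is inherited by supersets. Summands that vanish on sets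
with `N`, and otherwise are paid only by clients whose own facility makes `N` true, at most their
opening probability, add up to at most `1`: the sum counts opened facilities until the first one
that makes `N` true. -/
theorem runSum_until_le_one (hq0 : ∀ x S, 0 ≤ q x S) (hq1 : ∀ x S, q x S ≤ 1)
    {φ : C → Finset A → ℝ} {N : Finset A → Prop} (hN : ∀ S a, N S → N (insert a S))
    (h0 : ∀ x S, N S → φ x S ≤ 0)
    (h1 : ∀ x S, φ x S ≤ 0 ∨ (φ x S ≤ q x S ∧ N (insert (fac x) S))) (l : List C) :
    ∀ S, runSum q fac φ l S ≤ 1 := by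
  have hz : ∀ (l : List C) S, N S → runSum q fac φ l S ≤ 0 := fun l S hS =>
    (runSum_mono_of hq0 hq1 hN h0 l S hS).trans_eq (runSum_zero l S)
  induction l with
  | nil => intro S; simp [runSum]
  | cons x l ih =>
    intro S
    have hq0' := hq0 x S
    have hq1' := sub_nonneg.2 (hq1 x S)
    have h2 := mul_le_mul_of_nonneg_left (ih S) hq1'
    simp only [runSum]
    rcases h1 x S with h | ⟨h, hn⟩
    · have h3 := mul_le_mul_of_nonneg_left (ih (insert (fac x) S)) hq0'
      linarith
    · have h3 := mul_le_mul_of_nonneg_left (hz l _ hn) hq0'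
      linarith

section Single

variable [DecidableEq C]

theorem runSum_single_of_notMem (w : C → Finset A → ℝ) {x : C} (l : List C) (hx : x ∉ l) :
    ∀ S, runSum q fac (single w x) l S = 0 := by
  induction l with
  | nil => intro S; rfl
  | cons y l ih =>
    intro S
    rw [List.mem_cons, not_or] at hx
    simp [runSum, ih hx.2, single, Ne.symm hx.1]

/-- A client occurs at most once, so it pays at most the largest cost that it may meet. -/
theorem runSum_single_le (hq0 : ∀ x S, 0 ≤ q x S) (hq1 : ∀ x S, q x S ≤ 1)
    {w : C → Finset A → ℝ} {x : C} {M : ℝ} (hM : 0 ≤ M) (l : List C) (hl : l.Nodup) :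
    ∀ S, (∀ S', S ⊆ S' → w x S' ≤ M) → runSum q fac (single w x) l S ≤ M := by
  induction l with
  | nil => intro S _; simpa [runSum] using hM
  | cons y l ih =>
    intro S hS
    rw [List.nodup_cons] at hl
    simp only [runSum]
    by_cases hy : y = x
    · subst hy
      rw [runSum_single_of_notMem w l hl.1, runSum_single_of_notMem w l hl.1]
      simpa [single] using hS S subset_rfl
    · have h1 := mul_le_mul_of_nonneg_left (ih hl.2 (insert (fac y) S)
        (fun S' h => hS S' ((Finset.subset_insert _ _).trans h))) (hq0 y S)
      have h2 := mul_le_mul_of_nonneg_left (ih hl.2 S hS) (sub_nonneg.2 (hq1 y S))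
      have h3 : single w x y S = 0 := by simp [single, hy]
      linarith

theorem avgOrders_runSum_rec {U : Finset C} (hU : U.Nonempty) (φ : C → Finset A → ℝ)
    (S : Finset A) :
    avgOrders U (fun l => runSum q fac φ l S)
      = (∑ y ∈ U, (φ y S
          + (q y S * avgOrders (U.erase y) (fun l => runSum q fac φ l (insert (fac y) S))
            + (1 - q y S) * avgOrders (U.erase y) (fun l => runSum q fac φ l S)))) / U.card := by
  rw [avgOrders_rec hU]
  congr 1
  refine Finset.sum_congr rfl fun y _ => ?_
  simp only [runSum]
  rw [avgOrders_add, avgOrders_const, avgOrders_add, avgOrders_mul_left, avgOrders_mul_left]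

/-- Two clients `x` and `g` in random order, such that `x` pays at most `c` more than `g` would
have paid at the same moment or earlier. If `g` comes first, `x` is charged to the payment of `g`.
If `x` comes first, then `g` was equally likely to be considered at that moment, so that the
payment of `x` is charged to the payment of `g` in the ordering with `x` and `g` exchanged. -/
theorem avgOrders_single_le (hq0 : ∀ x S, 0 ≤ q x S) (hq1 : ∀ x S, q x S ≤ 1)
    {w : C → Finset A → ℝ} (hw : ∀ x S, 0 ≤ w x S) {x g : C} (hxg : x ≠ g) {c : ℝ} (hc : 0 ≤ c)
    (h : ∀ S S' : Finset A, S.Nonempty → S ⊆ S' → w x S' ≤ w g S + c) (U : Finset C) :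
    g ∈ U → ∀ S : Finset A, S.Nonempty →
      avgOrders U (fun l => runSum q fac (single w x) l S)
        ≤ 2 * avgOrders U (fun l => runSum q fac (single w g) l S) + 2 * c := by
  induction U using Finset.strongInduction with
  | H U ih =>
    intro hgU S hS
    have hU : U.Nonempty := ⟨g, hgU⟩
    have hnn : ∀ (V : Finset C) (S : Finset A),
        0 ≤ avgOrders V (fun l => runSum q fac (single w g) l S) := fun V S =>
      avgOrders_nonneg fun l => runSum_nonneg hq0 hq1 (single_nonneg hw g) l S
    by_cases hxU : x ∉ U
    · have h1 : avgOrders U (fun l => runSum q fac (single w x) l S) ≤ 0 :=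
        avgOrders_le fun l hl => by
          rw [runSum_single_of_notMem w l (fun hx => hxU (((mem_orders.1 hl).2 x).1 hx))]
      linarith [hnn U S]
    rw [not_not] at hxU
    have hcard : (0 : ℝ) < U.card := by exact_mod_cast Finset.card_pos.2 hU
    rw [avgOrders_runSum_rec hU, avgOrders_runSum_rec hU, div_le_iff₀ hcard, add_mul, mul_assoc,
      div_mul_cancel₀ _ hcard.ne']
    -- The corrections `w g S` at `x` and at `g` cancel in the sum over the next client.
    have key : ∀ y ∈ U, single w x y S
          + (q y S * avgOrders (U.erase y)
              (fun l => runSum q fac (single w x) l (insert (fac y) S))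
            + (1 - q y S) * avgOrders (U.erase y) (fun l => runSum q fac (single w x) l S))
        ≤ 2 * (single w g y S
          + (q y S * avgOrders (U.erase y)
              (fun l => runSum q fac (single w g) l (insert (fac y) S))
            + (1 - q y S) * avgOrders (U.erase y) (fun l => runSum q fac (single w g) l S)))
          + 2 * c + (if y = x then w g S else 0) - (if y = g then w g S else 0) := by
      intro y hy
      have hp := hq0 y S
      have hp' := sub_nonneg.2 (hq1 y S)
      have a1 := mul_nonneg hp (hnn (U.erase y) (insert (fac y) S))
      have a2 := mul_nonneg hp' (hnn (U.erase y) S)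
      by_cases hyx : y = x
      · subst hyx
        have hz : ∀ S, avgOrders (U.erase y) (fun l => runSum q fac (single w y) l S) ≤ 0 :=
          fun S => avgOrders_le fun l hl => by
            rw [runSum_single_of_notMem w l
              (fun hx => Finset.notMem_erase y U (((mem_orders.1 hl).2 y).1 hx))]
        have b1 := mul_le_mul_of_nonneg_left (hz (insert (fac y) S)) hp
        have b2 := mul_le_mul_of_nonneg_left (hz S) hp'
        have b3 := h S S hS subset_rfl
        simp only [single, if_true, if_neg hxg]
        linarith
      · by_cases hyg : y = g
        · subst hyg
          have hM : ∀ T, S ⊆ T →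
              avgOrders (U.erase y) (fun l => runSum q fac (single w x) l T) ≤ w y S + c :=
            fun T hT => avgOrders_le fun l hl =>
              runSum_single_le hq0 hq1 (add_nonneg (hw y S) hc) l (mem_orders.1 hl).1 T
                fun S' hS' => h S S' hS (hT.trans hS')
          have b1 := mul_le_mul_of_nonneg_left (hM _ (Finset.subset_insert (fac y) S)) hp
          have b2 := mul_le_mul_of_nonneg_left (hM S subset_rfl) hp'
          simp only [single, if_true, if_neg hyx]
          linarith
        · have hlt := Finset.erase_ssubset hy
          have hg' : g ∈ U.erase y := Finset.mem_erase.2 ⟨Ne.symm hyg, hgU⟩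
          have b1 := mul_le_mul_of_nonneg_left
            (ih _ hlt hg' (insert (fac y) S) (Finset.insert_nonempty _ _)) hp
          have b2 := mul_le_mul_of_nonneg_left (ih _ hlt hg' S hS) hp'
          simp only [single, if_neg hyx, if_neg hyg]
          linarith
    refine (Finset.sum_le_sum key).trans_eq ?_
    rw [Finset.sum_sub_distrib, Finset.sum_add_distrib, Finset.sum_add_distrib, ← Finset.mul_sum,
      Finset.sum_ite_eq', Finset.sum_ite_eq', if_pos hxU, if_pos hgU, Finset.sum_const,
      nsmul_eq_mul]
    ring

end Single

end Run

/-! ### The number of facilities opened by one cluster -/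

section Cluster

variable {C A : Type*} [DecidableEq C] [DecidableEq A] {q : C → Finset A → ℝ} {fac : C → A}

/-- Let the clients of a cluster `K` be split into good ones, `G`, and bad ones, at most as many.
Once a facility of a good client is open, `x` opens its facility with probability at most `e x`.
Before, the good clients open at most one facility, and each bad client is charged to the average
good client by `avgOrders_single_le`. -/
theorem avgOrders_cluster_le (hq0 : ∀ x S, 0 ≤ q x S) (hq1 : ∀ x S, q x S ≤ 1)
    {K G : Finset C} (hGK : G ⊆ K) (hcard : (K \ G).card ≤ G.card) {e c : C → ℝ}
    (he0 : ∀ x, 0 ≤ e x) (hc0 : ∀ x, 0 ≤ c x)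
    (he : ∀ x ∈ K, ∀ S, (∃ g ∈ G, fac g ∈ S) → q x S ≤ e x)
    (hc : ∀ x ∈ K \ G, ∀ g ∈ G, ∀ S S' : Finset A, S.Nonempty → S ⊆ S' →
      q x S' ≤ q g S + c x)
    {U : Finset C} {S : Finset A} (hS : S.Nonempty) (hU : ∀ y, y ∉ U → fac y ∈ S) :
    avgOrders U (fun l => runSum q fac (fun x S => if x ∈ K then q x S else 0) l S)
      ≤ 3 + ∑ x ∈ K, e x + 2 * ∑ x ∈ K \ G, c x := by
  classical
  set N : Finset A → Prop := fun S => ∃ g ∈ G, fac g ∈ S with hN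
  have hNmono : ∀ S T, S ⊆ T → N S → N T := fun S T hST ⟨g, hg, hgS⟩ => ⟨g, hg, hST hgS⟩
  have hNins : ∀ S a, N S → N (insert a S) := fun S a => hNmono _ _ (Finset.subset_insert _ _)
  set w : C → Finset A → ℝ := fun x S => if N S then 0 else q x S with hw
  have hw0 : ∀ x S, 0 ≤ w x S := by
    intro x S
    simp only [hw]
    split_ifs
    exacts [le_rfl, hq0 x S]
  have hwN : ∀ x S, N S → w x S = 0 := fun x S h => if_pos h
  have hwq : ∀ x S, w x S ≤ q x S := by
    intro x S
    simp only [hw]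
    split_ifs
    exacts [hq0 x S, le_rfl]
  have hsum : ∀ (D : Finset C) (y : C) (T : Finset A),
      ∑ x ∈ D, single w x y T = if y ∈ D then w y T else 0 := by
    intro D y T
    simp only [single]
    exact Finset.sum_ite_eq D y _
  -- The first term bounds the payments after a good facility is open; `w` is what is paid before.
  have hsplit : ∀ x S, (if x ∈ K then q x S else 0)
      ≤ (if x ∈ K then e x else 0)
        + (∑ g ∈ G, single w g x S + ∑ b ∈ K \ G, single w b x S) := by
    intro x S
    rw [hsum, hsum]
    by_cases hxK : x ∈ K
    · rw [if_pos hxK, if_pos hxK]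
      have h1 : q x S ≤ e x + w x S := by
        by_cases h : N S
        · linarith [he x hxK S h, hw0 x S]
        · have : w x S = q x S := if_neg h
          linarith [he0 x]
      by_cases hxG : x ∈ G
      · simpa [hxG] using h1
      · simpa [hxG, hxK] using h1
    · have : x ∉ G := fun h => hxK (hGK h)
      simp [hxK, this]
  have h1 : avgOrders U (fun l => runSum q fac (fun x S => if x ∈ K then q x S else 0) l S)
      ≤ avgOrders U (fun l => (l.map fun x => if x ∈ K then e x else 0).sum)
        + (∑ g ∈ G, avgOrders U (fun l => runSum q fac (single w g) l S)
          + ∑ b ∈ K \ G, avgOrders U (fun l => runSum q fac (single w b) l S)) := by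
    rw [← avgOrders_sum, ← avgOrders_sum, ← avgOrders_add, ← avgOrders_add]
    refine avgOrders_mono fun l _ => ?_
    refine (runSum_mono hq0 hq1 hsplit l S).trans_eq ?_
    rw [runSum_add, runSum_const, runSum_add, runSum_sum, runSum_sum]
  have h2 : avgOrders U (fun l => (l.map fun x => if x ∈ K then e x else 0).sum)
      ≤ ∑ x ∈ K, e x := by
    refine avgOrders_le fun l hl => ?_
    rw [← List.sum_toFinset _ (mem_orders.1 hl).1, ← Finset.sum_filter]
    exact Finset.sum_le_sum_of_subset_of_nonneg
      (fun x hx => (Finset.mem_filter.1 hx).2) fun x _ _ => he0 x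
  have h3 : ∑ g ∈ G, avgOrders U (fun l => runSum q fac (single w g) l S) ≤ 1 := by
    rw [← avgOrders_sum]
    refine avgOrders_le fun l _ => ?_
    rw [← runSum_sum]
    refine runSum_until_le_one hq0 hq1 hNins ?_ ?_ l S
    · intro x S hNS
      rw [hsum, hwN x S hNS, ite_self]
    · intro x S
      rw [hsum]
      by_cases hx : x ∈ G
      · exact Or.inr ⟨by simpa [hx] using hwq x S, x, hx, Finset.mem_insert_self _ _⟩
      · exact Or.inl (by simp [hx])
  have hwc : ∀ x ∈ K \ G, ∀ g ∈ G, ∀ S S' : Finset A, S.Nonempty → S ⊆ S' →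
      w x S' ≤ w g S + c x := by
    intro x hx g hg S S' hS hSS'
    by_cases h : N S'
    · rw [hwN x S' h]
      exact add_nonneg (hw0 g S) (hc0 x)
    · have h4 : w g S = q g S := if_neg fun h' => h (hNmono S S' hSS' h')
      rw [h4]
      exact (hwq x S').trans (hc x hx g hg S S' hS hSS')
  have h4 : ∀ b ∈ K \ G, ∀ g ∈ G, avgOrders U (fun l => runSum q fac (single w b) l S)
      ≤ 2 * avgOrders U (fun l => runSum q fac (single w g) l S) + 2 * c b := by
    intro b hb g hg
    have hbg : b ≠ g := by
      rintro rfl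
      exact (Finset.mem_sdiff.1 hb).2 hg
    by_cases hgU : g ∈ U
    · exact avgOrders_single_le hq0 hq1 hw0 hbg (hc0 b) (hwc b hb g hg) U hgU S hS
    · have hNS : N S := ⟨g, hg, hU g hgU⟩
      have h5 : avgOrders U (fun l => runSum q fac (single w b) l S) ≤ 0 :=
        avgOrders_le fun l hl => runSum_single_le hq0 hq1 le_rfl l (mem_orders.1 hl).1 S
          fun S' hS' => (hwN b S' (hNmono S S' hS' hNS)).le
      have h6 : 0 ≤ avgOrders U (fun l => runSum q fac (single w g) l S) :=
        avgOrders_nonneg fun l => runSum_nonneg hq0 hq1 (single_nonneg hw0 g) l S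
      linarith [hc0 b]
  have h5 : ∑ b ∈ K \ G, avgOrders U (fun l => runSum q fac (single w b) l S)
      ≤ 2 + 2 * ∑ x ∈ K \ G, c x := by
    rcases (K \ G).eq_empty_or_nonempty with hbad | hbad
    · simp [hbad]
    have hGpos : (0 : ℝ) < G.card := by
      exact_mod_cast (Finset.card_pos.2 hbad).trans_le hcard
    have h6 : ∀ b ∈ K \ G, avgOrders U (fun l => runSum q fac (single w b) l S)
        ≤ 2 / G.card + 2 * c b := by
      intro b hb
      have h7 := Finset.sum_le_sum (h4 b hb)
      rw [Finset.sum_const, nsmul_eq_mul, Finset.sum_add_distrib, Finset.sum_const, nsmul_eq_mul,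
        ← Finset.mul_sum] at h7
      have h8 : avgOrders U (fun l => runSum q fac (single w b) l S)
          ≤ (2 + G.card * (2 * c b)) / G.card := by
        rw [le_div_iff₀ hGpos]
        linarith
      rwa [add_div, mul_div_cancel_left₀ _ hGpos.ne'] at h8
    refine (Finset.sum_le_sum h6).trans ?_
    rw [Finset.sum_add_distrib, Finset.sum_const, nsmul_eq_mul, ← Finset.mul_sum]
    have h9 : ((K \ G).card : ℝ) ≤ G.card := by exact_mod_cast hcard
    have h10 : ((K \ G).card : ℝ) * (2 / G.card) ≤ 2 := by
      rw [mul_div_assoc', div_le_iff₀ hGpos]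
      linarith
    linarith
  linarith

end Cluster

/-! ### Distances and top costs -/

section TopCost

variable {C A : Type*} [Fintype C]

theorem topCost_le_add_sum (ℓ : ℕ) (v : C → ℝ) {s : ℝ} (hs : 0 ≤ s) :
    topCost ℓ v ≤ ℓ * s + ∑ j, max (v j - s) 0 := by
  unfold topCost
  set L := (Finset.univ.val.map v).sort (fun x y => x ≥ y) with hL
  have h1 : ∑ j, max (v j - s) 0 = (L.map fun x => max (x - s) 0).sum := by
    have h : (L : Multiset ℝ) = Finset.univ.val.map v := Multiset.sort_eq _ _
    rw [← Multiset.sum_coe, ← Multiset.map_coe, h, Multiset.map_map]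
    rfl
  have h2 : ∀ l : List ℝ, l.sum ≤ l.length * s + (l.map fun x => max (x - s) 0).sum := by
    intro l
    induction l with
    | nil => simp
    | cons x l ih =>
      simp only [List.sum_cons, List.length_cons, List.map_cons]
      push_cast
      linarith [le_max_left (x - s) 0]
  have h3 : ((L.take ℓ).map fun x => max (x - s) 0).sum ≤ (L.map fun x => max (x - s) 0).sum :=
    ((List.take_sublist ℓ L).map _).sum_le_sum fun x hx => by
      obtain ⟨y, _, rfl⟩ := List.mem_map.1 hx
      exact le_max_right _ _
  have h4 : (((L.take ℓ).length : ℕ) : ℝ) * s ≤ ℓ * s := by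
    gcongr
    exact List.length_take_le _ _
  rw [h1]
  linarith [h2 (L.take ℓ)]

/-- If the `ℓ` largest entries add up to at most `ℓ * s`, then all entries above `s` are among
them. -/
theorem sum_excess_le_topCost {ℓ : ℕ} {v : C → ℝ} (hv : ∀ j, 0 ≤ v j) {s : ℝ} (hs : 0 ≤ s)
    (hℓ : 1 ≤ ℓ) (h : topCost ℓ v ≤ ℓ * s) : ∑ j, max (v j - s) 0 ≤ topCost ℓ v := by
  unfold topCost at *
  set L := (Finset.univ.val.map v).sort (fun x y => x ≥ y) with hL
  have hcoe : (L : Multiset ℝ) = Finset.univ.val.map v := Multiset.sort_eq _ _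
  have h1 : ∑ j, max (v j - s) 0 = (L.map fun x => max (x - s) 0).sum := by
    rw [← Multiset.sum_coe, ← Multiset.map_coe, hcoe, Multiset.map_map]
    rfl
  have hL0 : ∀ x ∈ L, 0 ≤ x := by
    intro x hx
    rw [← Multiset.mem_coe, hcoe, Multiset.mem_map] at hx
    obtain ⟨j, _, rfl⟩ := hx
    exact hv j
  have hsorted : (L.take ℓ ++ L.drop ℓ).Pairwise (fun x y => x ≥ y) := by
    rw [List.take_append_drop]
    exact Multiset.pairwise_sort _ _
  rw [List.pairwise_append] at hsorted
  have hdrop : ∀ y ∈ L.drop ℓ, y ≤ s := by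
    intro y hy
    by_contra! hys
    have hlen : (L.take ℓ).length = ℓ := by
      have := List.length_pos_of_mem hy
      rw [List.length_drop] at this
      rw [List.length_take]
      omega
    have h2 := List.card_nsmul_le_sum (L.take ℓ) y fun x hx => hsorted.2.2 x hx y hy
    rw [hlen, nsmul_eq_mul] at h2
    have h3 : (1 : ℝ) ≤ ℓ := by exact_mod_cast hℓ
    nlinarith
  have h2 : ((L.drop ℓ).map fun x => max (x - s) 0).sum = 0 := by
    refine List.sum_eq_zero fun x hx => ?_
    obtain ⟨y, hy, rfl⟩ := List.mem_map.1 hx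
    exact max_eq_right (by linarith [hdrop y hy])
  have h3 : ((L.take ℓ).map fun x => max (x - s) 0).sum ≤ ((L.take ℓ).map id).sum := by
    refine List.sum_le_sum fun x hx => ?_
    have := hL0 x (List.mem_of_mem_take hx)
    exact max_le (by simpa using hs) this
  rw [List.map_id] at h3
  rw [h1]
  conv_lhs => rw [← List.take_append_drop ℓ L]
  rw [List.map_append, List.sum_append, h2, add_zero]
  exact h3

theorem topCost_nonneg (ℓ : ℕ) {v : C → ℝ} (hv : ∀ j, 0 ≤ v j) : 0 ≤ topCost ℓ v := by
  refine List.sum_nonneg fun x hx => ?_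
  have := List.mem_of_mem_take hx
  rw [Multiset.mem_sort, Multiset.mem_map] at this
  obtain ⟨j, _, rfl⟩ := this
  exact hv j

end TopCost

section Dist

variable {C A : Type*} {d : C → A → ℝ}

theorem distTo_le {S : Finset A} {a : A} (ha : a ∈ S) (j : C) : distTo d j S ≤ d j a := by
  have h : S.Nonempty := ⟨a, ha⟩
  rw [distTo, dif_pos h]
  exact Finset.inf'_le _ ha

theorem exists_distTo_eq {S : Finset A} (hS : S.Nonempty) (d : C → A → ℝ) (j : C) :
    ∃ a ∈ S, distTo d j S = d j a := by
  rw [distTo, dif_pos hS]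
  exact Finset.exists_mem_eq_inf' hS (d j)

theorem distTo_anti {S T : Finset A} (hS : S.Nonempty) (hST : S ⊆ T) (j : C) :
    distTo d j T ≤ distTo d j S := by
  obtain ⟨a, ha, h⟩ := exists_distTo_eq hS d j
  rw [h]
  exact distTo_le (hST ha) j

theorem distTo_nonneg (hd : ∀ j a, 0 ≤ d j a) (j : C) (S : Finset A) : 0 ≤ distTo d j S := by
  rcases S.eq_empty_or_nonempty with rfl | hS
  · simp [distTo]
  · obtain ⟨a, _, h⟩ := exists_distTo_eq hS d j
    rw [h]
    exact hd j a

/-- The amount by which the distance of `j` to `S` exceeds the threshold. -/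
noncomputable def excess (d : C → A → ℝ) (thr : ℝ) (j : C) (S : Finset A) : ℝ :=
  max (distTo d j S - thr) 0

theorem excess_nonneg (thr : ℝ) (j : C) (S : Finset A) : 0 ≤ excess d thr j S :=
  le_max_right _ _

theorem excess_anti (thr : ℝ) {S T : Finset A} (hS : S.Nonempty) (hST : S ⊆ T) (j : C) :
    excess d thr j T ≤ excess d thr j S :=
  max_le_max_right _ (sub_le_sub_right (distTo_anti hS hST j) _)

theorem cost_le_add_sum_excess [Fintype C] (ℓ : ℕ) {thr : ℝ} (hthr : 0 ≤ thr) (S : Finset A) :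
    cost d ℓ S ≤ ℓ * thr + ∑ j, excess d thr j S :=
  topCost_le_add_sum ℓ _ hthr

end Dist

/-! ### The cost of a run in terms of opening probabilities -/

section Loop

variable {C A : Type*} [DecidableEq A] {d : C → A → ℝ} {fac : C → A} {thr f : ℝ}

/-- The probability with which the algorithm opens the facility of `x` when the set is `S`. -/
noncomputable def openPr (d : C → A → ℝ) (thr f : ℝ) (x : C) (S : Finset A) : ℝ :=
  prob (excess d thr x S) f

theorem subset_of_mem_support_meyersonLoop (l : List C) :
    ∀ S, ∀ T ∈ (meyersonLoop d fac thr f l S).support, S ⊆ T := by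
  induction l with
  | nil =>
    intro S T hT
    rw [meyersonLoop, PMF.support_pure, Set.mem_singleton_iff] at hT
    rw [hT]
  | cons x l ih =>
    intro S T hT
    rw [meyersonLoop, PMF.mem_support_bind_iff] at hT
    obtain ⟨b, _, hT⟩ := hT
    refine subset_trans ?_ (ih _ T hT)
    cases b
    · simp
    · simp

/-- The expected number of clients after the first one that open their facilities. -/
noncomputable def tailSum (d : C → A → ℝ) (fac : C → A) (thr f : ℝ) : List C → ℝ
  | [] => 0
  | x :: xs => runSum (openPr d thr f) fac (openPr d thr f) xs {fac x}

theorem avgOrders_tailSum_le [Fintype C] [DecidableEq C] [Nonempty C] {Q : ℝ}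
    (hQ : ∀ x, avgOrders (Finset.univ.erase x)
      (fun l => runSum (openPr d thr f) fac (openPr d thr f) l {fac x}) ≤ Q) :
    avgOrders Finset.univ (tailSum d fac thr f) ≤ Q := by
  have hcard : (0 : ℝ) < (Finset.univ : Finset C).card := by
    exact_mod_cast Finset.card_pos.2 Finset.univ_nonempty
  rw [avgOrders_rec Finset.univ_nonempty, div_le_iff₀ hcard, mul_comm, ← nsmul_eq_mul]
  exact Finset.sum_le_card_nsmul _ _ _ fun x _ => hQ x

variable [Fintype A]

theorem expect_meyersonLoop_cons (x : C) (l : List C) (S : Finset A) (h : Finset A → ℝ) :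
    expect (meyersonLoop d fac thr f (x :: l) S) h
      = openPr d thr f x S * expect (meyersonLoop d fac thr f l (insert (fac x) S)) h
        + (1 - openPr d thr f x S) * expect (meyersonLoop d fac thr f l S) h := by
  rw [meyersonLoop, expect_bind, expect_coin]
  rfl

theorem expect_card_meyersonLoop_le (l : List C) :
    ∀ S, expect (meyersonLoop d fac thr f l S) (fun T => (T.card : ℝ))
      ≤ S.card + runSum (openPr d thr f) fac (openPr d thr f) l S := by
  induction l with
  | nil => intro S; simp [meyersonLoop, expect_pure, runSum]
  | cons x l ih =>
    intro S
    rw [expect_meyersonLoop_cons, runSum]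
    have hp := prob_nonneg (excess d thr x S) f
    have hp' := sub_nonneg.2 (prob_le_one (excess d thr x S) f)
    have h1 := mul_le_mul_of_nonneg_left (ih (insert (fac x) S)) hp
    have h2 := mul_le_mul_of_nonneg_left (ih S) hp'
    have h3 : ((insert (fac x) S).card : ℝ) ≤ S.card + 1 := by
      exact_mod_cast Finset.card_insert_le _ _
    have h4 := mul_le_mul_of_nonneg_left h3 hp
    unfold openPr at *
    linarith

/-- The final excesses add up to at most the expected opening costs plus the excesses `ρ` of the
clients to their own facilities. -/
theorem expect_excess_meyersonLoop_le (hf : 0 ≤ f) {ρ : C → ℝ}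
    (hρ : ∀ x S, fac x ∈ S → excess d thr x S ≤ ρ x) (hρ0 : ∀ x, 0 ≤ ρ x) (l : List C) :
    ∀ S : Finset A, S.Nonempty → expect (meyersonLoop d fac thr f l S)
        (fun T => (l.map fun x => excess d thr x T).sum)
      ≤ f * runSum (openPr d thr f) fac (openPr d thr f) l S + (l.map ρ).sum := by
  induction l with
  | nil => intro S _; simp [meyersonLoop, expect_pure, runSum]
  | cons x l ih =>
    intro S hS
    have hp := prob_nonneg (excess d thr x S) f
    have hp1 := prob_le_one (excess d thr x S) f
    have hp' := sub_nonneg.2 hp1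
    have hx : ∀ T : Finset A, T.Nonempty → expect (meyersonLoop d fac thr f l T)
        (excess d thr x) ≤ excess d thr x T := fun T hT =>
      (expect_mono_support _ fun T' hT' =>
        excess_anti thr hT (subset_of_mem_support_meyersonLoop l T T' hT') x).trans_eq
          (expect_const _ _)
    have hne : (insert (fac x) S).Nonempty := Finset.insert_nonempty _ _
    have h1 := mul_le_mul_of_nonneg_left (ih (insert (fac x) S) hne) hp
    have h2 := mul_le_mul_of_nonneg_left (ih S hS) hp'
    have h3 := mul_le_mul_of_nonneg_left
      ((hx _ hne).trans (hρ x _ (Finset.mem_insert_self _ _))) hp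
    have h4 := mul_le_mul_of_nonneg_left (hx S hS) hp'
    have h5 := one_sub_prob_mul_le hf (excess_nonneg (d := d) thr x S)
    have h6 := mul_le_mul_of_nonneg_right hp1 (hρ0 x)
    rw [expect_meyersonLoop_cons, runSum]
    simp only [List.map_cons, List.sum_cons]
    rw [expect_add, expect_add]
    change prob (excess d thr x S) f * (expect _ (excess d thr x) + _)
      + (1 - prob (excess d thr x S) f) * (expect _ (excess d thr x) + _) ≤ _
    unfold openPr at *
    linarith

variable [Fintype C] [DecidableEq C]

theorem expect_randomOrderMeyerson (h : Finset A → ℝ) :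
    expect (randomOrderMeyerson d fac thr f) h
      = avgOrders Finset.univ (fun l => expect (meyerson d fac thr f l) h) := by
  rw [randomOrderMeyerson, expect_bind,
    ← expect_uniform_ofFn (fun l => expect (meyerson d fac thr f l) h)]

theorem expect_card_randomOrderMeyerson_le :
    expect (randomOrderMeyerson d fac thr f) (fun S => (S.card : ℝ))
      ≤ 1 + avgOrders Finset.univ (tailSum d fac thr f) := by
  rw [expect_randomOrderMeyerson, ← avgOrders_const (Finset.univ : Finset C) 1, ← avgOrders_add]
  refine avgOrders_mono fun l _ => ?_
  cases l with
  | nil => simp [meyerson, tailSum, expect_pure]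
  | cons x l =>
    simpa [meyerson, tailSum] using
      expect_card_meyersonLoop_le (d := d) (fac := fac) (thr := thr) (f := f) l {fac x}

theorem expect_excess_randomOrderMeyerson_le (hf : 0 ≤ f) {ρ : C → ℝ}
    (hρ : ∀ x S, fac x ∈ S → excess d thr x S ≤ ρ x) (hρ0 : ∀ x, 0 ≤ ρ x) :
    expect (randomOrderMeyerson d fac thr f) (fun S => ∑ x, excess d thr x S)
      ≤ f * avgOrders Finset.univ (tailSum d fac thr f) + ∑ x, ρ x := by
  rw [expect_randomOrderMeyerson, ← avgOrders_const (Finset.univ : Finset C) (∑ x, ρ x),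
    ← avgOrders_mul_left, ← avgOrders_add]
  refine avgOrders_mono fun l hl => ?_
  rw [mem_orders] at hl
  have hsum : ∀ g : C → ℝ, ∑ x, g x = (l.map g).sum := by
    intro g
    rw [← List.sum_toFinset _ hl.1]
    congr 1
    ext x
    simp [hl.2 x]
  simp only [hsum]
  cases l with
  | nil => simp [meyerson, tailSum, expect_pure]
  | cons x l =>
    simp only [meyerson, tailSum, List.map_cons, List.sum_cons]
    rw [expect_add]
    have h1 : expect (meyersonLoop d fac thr f l {fac x}) (fun S => excess d thr x S) ≤ ρ x :=
      (expect_mono_support _ fun T hT => hρ x T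
        (subset_of_mem_support_meyersonLoop l _ T hT (Finset.mem_singleton_self _))).trans_eq
        (expect_const _ _)
    linarith [expect_excess_meyersonLoop_le hf hρ hρ0 l {fac x} (Finset.singleton_nonempty _)]

end Loop

/-! ### The opening probabilities of the optimal clusters -/

section Core

variable {C A : Type*} [DecidableEq C] [DecidableEq A] {d : C → A → ℝ} {fac : C → A}

/-- One cluster of the optimal solution: `K` is the set of its clients and `a` its centre, so that
`r x` bounds the excess of `d x a` over `t`. A client is good if `(1 + ν) r x` is at most twice the
average over the cluster, or at most `t`. The second alternative lets the bad clients pay for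
additive terms of order `t`, and it is harmless because of the slack of the threshold: a facility
opened by a client with `(1 + ν) r x ≤ t` is as good as the centre. -/
theorem avgOrders_optimal_cluster_le (hquad : ∀ x g a b, d x b ≤ d x a + d g a + d g b)
    {ν t f : ℝ} (hν : 0 ≤ ν) (ht : 0 ≤ t) (hf : 0 ≤ f) {K : Finset C} {a : A} {r : C → ℝ}
    (hr0 : ∀ x, 0 ≤ r x) (hr : ∀ x ∈ K, d x a ≤ r x + t) (hfr : f = 0 → ∀ x, r x = 0)
    (hfac : ∀ x ∈ K, d x (fac x) ≤ ν * d x a)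
    {U : Finset C} {S : Finset A} (hS : S.Nonempty) (hU : ∀ y, y ∉ U → fac y ∈ S) :
    avgOrders U (fun l => runSum (openPr d ((3 + ν) * t) f) fac
        (fun x S => if x ∈ K then openPr d ((3 + ν) * t) f x S else 0) l S)
      ≤ 3 + (11 + 6 * ν) * ((∑ x ∈ K, r x) / f) := by
  set R := ∑ x ∈ K, r x with hR
  have hR0 : 0 ≤ R := Finset.sum_nonneg fun x _ => hr0 x
  set v := 2 * ((1 + ν) * R) / K.card with hv
  have hv0 : 0 ≤ v := by positivity
  set G := K.filter (fun x => (1 + ν) * r x ≤ max v t) with hG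
  have hGK : G ⊆ K := Finset.filter_subset _ _
  have hbad : ∀ x ∈ K \ G, x ∈ K ∧ max v t < (1 + ν) * r x := by
    intro x hx
    rw [Finset.mem_sdiff, hG, Finset.mem_filter, not_and, not_le] at hx
    exact ⟨hx.1, hx.2 hx.1⟩
  have hfR : f = 0 → R = 0 := fun h => Finset.sum_eq_zero fun x _ => hfr h x
  -- Markov's inequality: at most half of the clients exceed twice the average.
  have hcard : (K \ G).card ≤ G.card := by
    rcases (K \ G).eq_empty_or_nonempty with h | h
    · simp [h]
    obtain ⟨x, hx⟩ := h
    have hKpos : (0 : ℝ) < K.card := by exact_mod_cast Finset.card_pos.2 ⟨x, (hbad x hx).1⟩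
    have h1 : ((K \ G).card : ℝ) * v ≤ ∑ x ∈ K \ G, (1 + ν) * r x := by
      rw [← nsmul_eq_mul]
      exact Finset.card_nsmul_le_sum _ _ _ fun y hy =>
        (le_max_left v t).trans (hbad y hy).2.le
    have h2 : ∑ x ∈ K \ G, (1 + ν) * r x ≤ (1 + ν) * R := by
      rw [← Finset.mul_sum]
      exact mul_le_mul_of_nonneg_left (Finset.sum_le_sum_of_subset_of_nonneg
        Finset.sdiff_subset fun x _ _ => hr0 x) (by linarith)
    have h3 : 0 < (1 + ν) * R := by
      have h4 : 0 < (1 + ν) * r x := hv0.trans_lt ((le_max_left v t).trans_lt (hbad x hx).2)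
      refine h4.trans_le (mul_le_mul_of_nonneg_left ?_ (by linarith))
      exact Finset.single_le_sum (fun y _ => hr0 y) (hbad x hx).1
    have h4 : v * K.card = 2 * ((1 + ν) * R) := div_mul_cancel₀ _ hKpos.ne'
    have h5 : 2 * ((K \ G).card : ℝ) ≤ K.card := by
      have h6 : ((K \ G).card : ℝ) * v ≤ (1 + ν) * R := h1.trans h2
      have h7 : 0 < v := by positivity
      nlinarith
    have h6 : 2 * (K \ G).card ≤ K.card := by exact_mod_cast h5
    have h7 := Finset.card_sdiff_add_card_eq_card hGK
    omega
  have hrd : ∀ x ∈ K, ∀ g ∈ K, ∀ b, d x b ≤ r x + r g + 2 * t + d g b := by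
    intro x hx g hg b
    linarith [hquad x g a b, hr x hx, hr g hg]
  have hpost : ∀ x ∈ K, ∀ S : Finset A, (∃ g ∈ G, fac g ∈ S) →
      openPr d ((3 + ν) * t) f x S ≤ (r x + v) / f := by
    rintro x hx S ⟨g, hg, hgS⟩
    rw [hG, Finset.mem_filter] at hg
    have h1 : distTo d x S ≤ r x + r g + 2 * t + ν * (r g + t) :=
      (distTo_le hgS x).trans ((hrd x hx g hg.1 _).trans
        (add_le_add le_rfl ((hfac g hg.1).trans (mul_le_mul_of_nonneg_left (hr g hg.1) hν))))
    have h2 : max v t ≤ v + t := max_le (by linarith) (by linarith)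
    have h3 : excess d ((3 + ν) * t) x S ≤ 0 + (r x + v) :=
      max_le (by linarith) (by linarith [hr0 x])
    have h4 := prob_le_add hf le_rfl (excess_nonneg _ _ _) (add_nonneg (hr0 x) hv0)
      (fun h => by rw [hfr h x, hv, hfR h]; simp) h3
    rwa [prob_zero, zero_add] at h4
  have hpre : ∀ x ∈ K \ G, ∀ g ∈ G, ∀ S S' : Finset A, S.Nonempty → S ⊆ S' →
      openPr d ((3 + ν) * t) f x S'
        ≤ openPr d ((3 + ν) * t) f g S + (4 + 2 * ν) * r x / f := by
    intro x hx g hg S S' hS hSS'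
    obtain ⟨hxK, hxr⟩ := hbad x hx
    rw [hG, Finset.mem_filter] at hg
    have h1 : r g ≤ r x := by
      have : (1 + ν) * r g ≤ (1 + ν) * r x := hg.2.trans hxr.le
      exact le_of_mul_le_mul_left this (by linarith)
    have h2 : t ≤ (1 + ν) * r x := (le_max_right v t).trans hxr.le
    have h3 : distTo d x S' ≤ (4 + 2 * ν) * r x + distTo d g S := by
      obtain ⟨b, hb, h⟩ := exists_distTo_eq hS d g
      rw [h]
      linarith [distTo_le (hSS' hb) x (d := d), hrd x hxK g hg.1 b]
    have hc : 0 ≤ (4 + 2 * ν) * r x := mul_nonneg (by linarith) (hr0 x)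
    refine prob_le_add hf (excess_nonneg _ _ _) (excess_nonneg _ _ _) hc
      (fun h => by rw [hfr h x, mul_zero]) (max_le ?_ ?_)
    · linarith [le_max_left (distTo d g S - (3 + ν) * t) 0, excess.eq_1 d ((3 + ν) * t) g S]
    · exact add_nonneg (excess_nonneg _ _ _) hc
  refine (avgOrders_cluster_le (fun x S => prob_nonneg _ _) (fun x S => prob_le_one _ _) hGK hcard
    (fun x => div_nonneg (add_nonneg (hr0 x) hv0) hf)
    (fun x => div_nonneg (mul_nonneg (by linarith) (hr0 x)) hf) hpost hpre hS hU).trans ?_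
  have h1 : ∑ x ∈ K, (r x + v) ≤ (3 + 2 * ν) * R := by
    rw [Finset.sum_add_distrib, Finset.sum_const, nsmul_eq_mul, ← hR]
    rcases K.eq_empty_or_nonempty with h | h
    · have : R = 0 := by rw [hR, h, Finset.sum_empty]
      simp [h, this]
    · have hK : (K.card : ℝ) ≠ 0 := by exact_mod_cast (Finset.card_pos.2 h).ne'
      rw [hv, mul_div_cancel₀ _ hK]
      linarith
  have h2 : ∑ x ∈ K \ G, (4 + 2 * ν) * r x ≤ (4 + 2 * ν) * R := by
    rw [← Finset.mul_sum]
    exact mul_le_mul_of_nonneg_left (Finset.sum_le_sum_of_subset_of_nonneg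
      Finset.sdiff_subset fun x _ _ => hr0 x) (by linarith)
  rw [← Finset.sum_div, ← Finset.sum_div, mul_div_assoc', add_assoc, mul_div_assoc', ← add_div]
  gcongr
  linarith

/-- The expected number of openings from any state in which the clients that are no longer to come
have open facilities, for a partition of the clients into clusters with centres in `T`. -/
theorem avgOrders_runSum_openPr_le [Fintype C]
    (hquad : ∀ x g a b, d x b ≤ d x a + d g a + d g b)
    {ν t f : ℝ} (hν : 0 ≤ ν) (ht : 0 ≤ t) (hf : 0 ≤ f) {T : Finset A} {κ : C → A}
    (hκ : ∀ x, κ x ∈ T) {r : C → ℝ}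
    (hr0 : ∀ x, 0 ≤ r x) (hr : ∀ x, d x (κ x) ≤ r x + t) (hfr : f = 0 → ∀ x, r x = 0)
    (hfac : ∀ x, d x (fac x) ≤ ν * d x (κ x))
    {U : Finset C} {S : Finset A} (hS : S.Nonempty) (hU : ∀ y, y ∉ U → fac y ∈ S) :
    avgOrders U (fun l => runSum (openPr d ((3 + ν) * t) f) fac (openPr d ((3 + ν) * t) f) l S)
      ≤ 3 * T.card + (11 + 6 * ν) * ((∑ x, r x) / f) := by
  have h1 : openPr d ((3 + ν) * t) f = fun x S => ∑ a ∈ T,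
      if x ∈ Finset.univ.filter (fun x => κ x = a) then openPr d ((3 + ν) * t) f x S else 0 := by
    funext x S
    simp [hκ x]
  have h2 : ∑ x, r x = ∑ a ∈ T, ∑ x ∈ Finset.univ.filter (fun x => κ x = a), r x :=
    (Finset.sum_fiberwise_of_maps_to (fun x _ => hκ x) r).symm
  have h3 : ∀ l, runSum (openPr d ((3 + ν) * t) f) fac (openPr d ((3 + ν) * t) f) l S
      = ∑ a ∈ T, runSum (openPr d ((3 + ν) * t) f) fac (fun x S =>
          if x ∈ Finset.univ.filter (fun x => κ x = a) then openPr d ((3 + ν) * t) f x S else 0)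
          l S := by
    intro l
    rw [← runSum_sum, ← h1]
  simp only [h3]
  rw [avgOrders_sum, h2, Finset.sum_div, Finset.mul_sum, mul_comm (3 : ℝ), ← nsmul_eq_mul,
    ← Finset.sum_const, ← Finset.sum_add_distrib]
  refine Finset.sum_le_sum fun a _ => ?_
  have hK : ∀ {x}, x ∈ Finset.univ.filter (fun x => κ x = a) → κ x = a := fun hx =>
    (Finset.mem_filter.1 hx).2
  exact avgOrders_optimal_cluster_le hquad hν ht hf hr0 (fun x hx => hK hx ▸ hr x) hfr
    (fun x hx => hK hx ▸ hfac x) hS hU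

end Core

/-! ### Expected size and expected cost of the returned set -/

theorem IsOptimal.opt_eq {C A : Type*} [Fintype C] {d : C → A → ℝ} {k ℓ : ℕ} {S : Finset A} (h : IsOptimal d k ℓ S) :
    OPT d k ℓ = cost d ℓ S := by
  refine IsLeast.csInf_eq ⟨⟨S, h.1, rfl⟩, ?_⟩
  rintro _ ⟨T, hT, rfl⟩
  exact h.2 T hT

theorem exists_isOptimal {C A : Type*} [Fintype C] [Fintype A] [Nonempty A] (d : C → A → ℝ) {k : ℕ} (hk : 1 ≤ k) (ℓ : ℕ) :
    ∃ S, IsOptimal d k ℓ S := by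
  obtain ⟨a⟩ := ‹Nonempty A›
  obtain ⟨S, hS, h⟩ := Set.exists_min_image {S : Finset A | Feasible k S} (cost d ℓ)
    (Set.toFinite _) ⟨{a}, Finset.singleton_nonempty a, by simpa using hk⟩
  exact ⟨S, hS, h⟩

section Bounds

variable {C A : Type*} [Fintype C] [DecidableEq C] [Fintype A] [DecidableEq A]
  {d : C → A → ℝ} {fac : C → A}

/-- The bounds for facilities `fac j` with `d j (fac j) ≤ ν d j S*`. The triangle inequality
enters in its bipartite form only. -/
theorem randomOrderMeyerson_bounds (hd : ∀ j a, 0 ≤ d j a)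
    (hquad : ∀ x g a b, d x b ≤ d x a + d g a + d g b)
    {k ℓ : ℕ} (hk : 1 ≤ k) (hℓ : 1 ≤ ℓ) (hℓC : ℓ ≤ Fintype.card C)
    {T : Finset A} (hT : IsOptimal d k ℓ T) {ν : ℝ} (hν : 0 ≤ ν)
    (hfac : ∀ j, d j (fac j) ≤ ν * distTo d j T) {B : ℝ} (hB : OPT d k ℓ ≤ B) :
    expect (randomOrderMeyerson d fac ((3 + ν) * (B / ℓ)) (B / k)) (fun S => (S.card : ℝ))
        ≤ (26 + 16 * ν) * k ∧
      expect (randomOrderMeyerson d fac ((3 + ν) * (B / ℓ)) (B / k)) (fun S => cost d ℓ S)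
        ≤ (15 + 4 * ν) * B + (14 + 13 * ν) * OPT d k ℓ := by
  have hk' : (1 : ℝ) ≤ k := by exact_mod_cast hk
  have hℓ' : (1 : ℝ) ≤ ℓ := by exact_mod_cast hℓ
  have hC : Nonempty C := Fintype.card_pos_iff.1 (by omega)
  have hopt := hT.opt_eq
  have hopt0 : 0 ≤ OPT d k ℓ := by
    rw [hopt]
    exact topCost_nonneg ℓ fun j => distTo_nonneg hd j T
  have hB0 : 0 ≤ B := hopt0.trans hB
  set t := B / ℓ with ht
  set f := B / k with hf
  have ht0 : 0 ≤ t := by positivity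
  have hf0 : 0 ≤ f := by positivity
  have hℓt : ℓ * t = B := mul_div_cancel₀ _ (by positivity)
  have hkf : k * f = B := mul_div_cancel₀ _ (by positivity)
  choose κ hκ hκd using exists_distTo_eq hT.1.1 d
  set r : C → ℝ := fun j => max (distTo d j T - t) 0 with hr
  have hr0 : ∀ j, 0 ≤ r j := fun j => le_max_right _ _
  have hrt : ∀ j, distTo d j T ≤ r j + t := fun j => by
    linarith [le_max_left (distTo d j T - t) 0]
  have hR : ∑ j, r j ≤ OPT d k ℓ := by
    rw [hopt]
    refine sum_excess_le_topCost (fun j => distTo_nonneg hd j T) ht0 hℓ ?_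
    rw [hℓt]
    exact hopt.ge.trans hB
  have hR0 : 0 ≤ ∑ j, r j := Finset.sum_nonneg fun j _ => hr0 j
  have hfr : f = 0 → ∀ j, r j = 0 := by
    intro h j
    have hB' : B = 0 := by rw [← hkf, h, mul_zero]
    have h1 := Finset.single_le_sum (fun j _ => hr0 j) (Finset.mem_univ j)
    exact le_antisymm (by linarith) (hr0 j)
  have hTk : (T.card : ℝ) ≤ k := by exact_mod_cast hT.1.2
  set Q := avgOrders Finset.univ (tailSum d fac ((3 + ν) * t) f) with hQ
  have hQle : Q ≤ 3 * k + (11 + 6 * ν) * ((∑ j, r j) / f) := by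
    refine (avgOrders_tailSum_le fun x => ?_).trans
      (add_le_add (mul_le_mul_of_nonneg_left hTk (by norm_num)) le_rfl)
    refine avgOrders_runSum_openPr_le hquad hν ht0 hf0 hκ hr0 (fun j => ?_) hfr (fun j => ?_)
      (Finset.singleton_nonempty _) ?_
    · rw [← hκd]
      exact hrt j
    · rw [← hκd]
      exact hfac j
    · intro y hy
      have : y = x := by simpa using hy
      simp [this]
  constructor
  · refine expect_card_randomOrderMeyerson_le.trans ?_
    have h1 : (∑ j, r j) / f ≤ k := div_le_of_le_mul₀ hf0 (by linarith) (by linarith)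
    have h2 := mul_le_mul_of_nonneg_left h1 (show 0 ≤ 11 + 6 * ν by linarith)
    have h3 := mul_nonneg hν (show (0 : ℝ) ≤ k by linarith)
    linarith
  · have hthr : 0 ≤ (3 + ν) * t := mul_nonneg (by linarith) ht0
    have h1 : expect (randomOrderMeyerson d fac ((3 + ν) * t) f) (fun S => cost d ℓ S)
        ≤ ℓ * ((3 + ν) * t) + (f * Q + ∑ j, ν * r j) := by
      refine (expect_mono _ fun S => cost_le_add_sum_excess ℓ hthr S).trans ?_
      rw [expect_add, expect_const]
      refine add_le_add le_rfl (expect_excess_randomOrderMeyerson_le hf0 ?_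
        fun j => mul_nonneg hν (hr0 j))
      intro j S hj
      have h2 := mul_le_mul_of_nonneg_left (hrt j) hν
      refine max_le ?_ (mul_nonneg hν (hr0 j))
      linarith [distTo_le hj j (d := d), hfac j]
    have h2 : f * Q ≤ 3 * B + (11 + 6 * ν) * ∑ j, r j := by
      have h3 : f * ((∑ j, r j) / f) ≤ ∑ j, r j := by
        rcases hf0.eq_or_lt with h | h
        · rwa [← h, zero_mul]
        · rw [mul_div_cancel₀ _ h.ne']
      nlinarith [mul_le_mul_of_nonneg_left hQle hf0]
    rw [← Finset.mul_sum] at h1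
    have h3 := mul_le_mul_of_nonneg_left hR (show 0 ≤ 11 + 7 * ν by linarith)
    have h4 := mul_nonneg hν hB0
    have h5 := mul_nonneg hν hopt0
    have h6 : ℓ * ((3 + ν) * t) = (3 + ν) * B := by rw [← hℓt]; ring
    linarith

end Bounds

end LCentrum

theorem mainTheorem6 :
    -- agents `C` and alternatives `A` located in a common (pseudo)metric space `X`
    (∀ (C A X : Type*) [Fintype C] [DecidableEq C] [Fintype A] [DecidableEq A] [Nonempty A]
        [PseudoMetricSpace X] (locC : C → X) (locA : A → X) (d : C → A → ℝ)
        (_ : ∀ j a, d j a = dist (locC j) (locA a))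
        (σ : LCentrum.Profile C A) (_ : LCentrum.Consistent d σ)
        (k ℓ : ℕ) (_ : 1 ≤ k) (_ : 1 ≤ ℓ) (_ : ℓ ≤ Fintype.card C)
        (Sopt : Finset A) (_ : LCentrum.IsOptimal d k ℓ Sopt)
        (ν : ℝ) (_ : ν = 0 ∨ ν = 1)
        (_ : ∀ j, d j (LCentrum.top σ j) ≤ ν * LCentrum.distTo d j Sopt)
        (B : ℝ) (_ : LCentrum.OPT d k ℓ ≤ B),
      LCentrum.expect (LCentrum.meyersonTopGen d σ k ℓ ν B) (fun S => (S.card : ℝ))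
          ≤ (26 + 16 * ν) * k ∧
      LCentrum.expect (LCentrum.meyersonTopGen d σ k ℓ ν B) (fun S => LCentrum.cost d ℓ S)
          ≤ (15 + 4 * ν) * B + (14 + 13 * ν) * LCentrum.OPT d k ℓ) ∧
    -- the case where the alternatives are the agents
    (∀ (C : Type*) [Fintype C] [DecidableEq C] [PseudoMetricSpace C]
        (k ℓ : ℕ) (_ : 1 ≤ k) (_ : 1 ≤ ℓ) (_ : ℓ ≤ Fintype.card C)
        (B : ℝ) (_ : LCentrum.OPT (fun i j : C => dist i j) k ℓ ≤ B),
      LCentrum.expect (LCentrum.meyersonTop (fun i j : C => dist i j) k ℓ B)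
          (fun S => (S.card : ℝ)) ≤ 26 * k ∧
      LCentrum.expect (LCentrum.meyersonTop (fun i j : C => dist i j) k ℓ B)
          (fun S => LCentrum.cost (fun i j : C => dist i j) ℓ S)
          ≤ 15 * B + 14 * LCentrum.OPT (fun i j : C => dist i j) k ℓ) := by
  constructor
  · intro C A X _ _ _ _ _ _ locC locA d hd σ _ k ℓ hk hℓ hℓC Sopt hopt ν hν hfac B hB
    have hν0 : 0 ≤ ν := by rcases hν with rfl | rfl <;> norm_num
    refine LCentrum.randomOrderMeyerson_bounds (fun j a => hd j a ▸ dist_nonneg) ?_ hk hℓ hℓC hopt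
      hν0 hfac hB
    intro x g a b
    simp only [hd]
    linarith [dist_triangle4 (locC x) (locA a) (locC g) (locA b),
      dist_comm (locA a) (locC g)]
  · intro C _ _ _ k ℓ hk hℓ hℓC B hB
    have hC : Nonempty C := Fintype.card_pos_iff.1 (by omega)
    obtain ⟨Sopt, hopt⟩ := LCentrum.exists_isOptimal (fun i j : C => dist i j) hk ℓ
    have h := LCentrum.randomOrderMeyerson_bounds (fac := id) (ν := 0)
      (fun j a : C => dist_nonneg (x := j) (y := a)) (fun x g a b => ?_) hk hℓ hℓC hopt le_rfl
      (fun j => by simp) hB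
    · simpa only [mul_zero, add_zero, LCentrum.meyersonTop] using h
    · linarith [dist_triangle4 x a g b, dist_comm a g]
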